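/- **Theorem (Cut Elimination for FLAFOL).** The Cut rule is admissible in the FLAFOL sequent calculus, for every choice of sorts, function symbols and relation symbols. *Language.* Fix a set of sorts containing two distinct sorts $\mathsf{Label}$ and $\mathsf{Principal}$, a set of typed function symbols, and a set of typed relation symbols containing $\sqsubseteq(\mathsf{Label},\mathsf{Label})$, $\mathsf{CanRead}(\mathsf{Principal},\mathsf{Label})$ and $\mathsf{CanWrite}(\mathsf{Principal},\mathsf{Label})$. There are countably infinitely many variables of each sort. Terms are the well-sorted terms $t ::= x \mid f(t_1,\dots,t_n)$; below, $p,q$ are terms of sort $\mathsf{Principal}$ and $\ell,\ell',\ell_i$ terms of sort $\mathsf{Label}$. Formulae, taken up to renaming of bound variables, are $$\varphi,\psi,\chi ::= R(t_1,\dots,t_n)\mid \mathsf{True}\mid\mathsf{False}\mid\varphi\land\psi\mid\varphi\lor\psi\mid\varphi\to\psi\mid\forall x{:}\sigma.\,\varphi\mid\exists x{:}\sigma.\,\varphi\mid p\ \mathsf{says}_\ell\ \varphi .$$ Generalized principals are finite stacks $g ::= \langle\rangle\mid g\cdot\langle p\rangle_\ell$; if $g'$ is a finite list of pairs $\langle p\rangle_\ell$,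 then $g\cdot g'$ is the extension of $g$ by $g'$. A belief is $\varphi @ g$, a context $\Gamma$ is a finite list of beliefs, and a sequent is $\Gamma\vdash\varphi @ g$. *Rules* (premises $\Rightarrow$ conclusion; $b$ is an arbitrary belief). - Ax: $\Gamma,\varphi@g\vdash\varphi@g$. Weakening: $\Gamma\vdash b\Rightarrow\Gamma,\varphi@g'\vdash b$. Contraction: $\Gamma,\varphi@g,\varphi@g\vdash b\Rightarrow\Gamma,\varphi@g\vdash b$. Exchange: $\Gamma,\varphi@g_1,\psi@g_2,\Gamma'\vdash b\Rightarrow\Gamma,\psi@g_2,\varphi@g_1,\Gamma'\vdash b$. - FalseL: $\Gamma,\mathsf{False}@g\vdash\varphi@g\cdot g'$. TrueR: $\Gamma\vdash\mathsf{True}@g$. - AndL: $\Gamma,\varphi@g,\psi@g\vdash b\Rightarrow\Gamma,(\varphi\land\psi)@g\vdash b$. AndR: $\Gamma\vdash\varphi@g$ and $\Gamma\vdash\psi@g\Rightarrow\Gamma\vdash(\varphi\land\psi)@g$. - OrL: $\Gamma,\varphi@g\vdash b$ and $\Gamma,\psi@g\vdash b\Rightarrow\Gamma,(\varphi\lor\psi)@g\vdash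 b$. OrR1: $\Gamma\vdash\varphi@g\Rightarrow\Gamma\vdash(\varphi\lor\psi)@g$. OrR2: $\Gamma\vdash\psi@g\Rightarrow\Gamma\vdash(\varphi\lor\psi)@g$. - ImpL: $\Gamma\vdash\varphi@\langle\rangle$ and $\Gamma,\psi@g\vdash b\Rightarrow\Gamma,(\varphi\to\psi)@g\vdash b$. ImpR: $\Gamma,\varphi@\langle\rangle\vdash\psi@g\Rightarrow\Gamma\vdash(\varphi\to\psi)@g$. - ForallL: $\Gamma,\varphi[x\mapsto t]@g\vdash b\Rightarrow\Gamma,(\forall x{:}\sigma.\varphi)@g\vdash b$ for any term $t$ of sort $\sigma$. ForallR: $\Gamma\vdash\varphi@g\Rightarrow\Gamma\vdash(\forall x{:}\sigma.\varphi)@g$ if $x$ is not free in $\Gamma,g$. - ExistsL: $\Gamma,\varphi@g\vdash b\Rightarrow\Gamma,(\exists x{:}\sigma.\varphi)@g\vdash b$ if $x$ is not free in $\Gamma,g,b$. ExistsR: $\Gamma\vdash\varphi[x\mapsto t]@g\Rightarrow\Gamma\vdash(\exists x{:}\sigma.\varphi)@g$ for any term $t$ of sort $\sigma$. - SaysL: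 $\Gamma,\varphi@g\cdot\langle p\rangle_\ell\vdash b\Rightarrow\Gamma,(p\ \mathsf{says}_\ell\ \varphi)@g\vdash b$. SaysR: $\Gamma\vdash\varphi@g\cdot\langle p\rangle_\ell\Rightarrow\Gamma\vdash(p\ \mathsf{says}_\ell\ \varphi)@g$. - SelfL (in both directions): $\Gamma,\varphi@g\cdot\langle p\rangle_\ell\cdot g'\vdash b\Leftrightarrow\Gamma,\varphi@g\cdot\langle p\rangle_\ell\cdot\langle p\rangle_\ell\cdot g'\vdash b$. SelfR (in both directions): $\Gamma\vdash\varphi@g\cdot\langle p\rangle_\ell\cdot g'\Leftrightarrow\Gamma\vdash\varphi@g\cdot\langle p\rangle_\ell\cdot\langle p\rangle_\ell\cdot g'$. - VarL: $\Gamma,\varphi@g\cdot\langle p\rangle_{\ell'}\cdot g'\vdash b$ and $\Gamma,\varphi@g\cdot\langle p\rangle_\ell\cdot g'\vdash(\ell\sqsubseteq\ell')@g\cdot\langle p\rangle_{\ell'}\Rightarrow\Gamma,\varphi@g\cdot\langle p\rangle_\ell\cdot g'\vdash b$. VarR: $\Gamma\vdash\varphi@g\cdot\langle p\rangle_{\ell'}\cdot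 g'$ and $\Gamma\vdash(\ell'\sqsubseteq\ell)@g\cdot\langle p\rangle_\ell\Rightarrow\Gamma\vdash\varphi@g\cdot\langle p\rangle_\ell\cdot g'$. - FwdL: $\Gamma,\varphi@g\cdot\langle q\rangle_\ell\cdot g'\vdash b$ and $\Gamma,\varphi@g\cdot\langle p\rangle_\ell\cdot g'\vdash\mathsf{CanRead}(q,\ell)@g\cdot\langle p\rangle_\ell$ and $\Gamma,\varphi@g\cdot\langle p\rangle_\ell\cdot g'\vdash\mathsf{CanWrite}(p,\ell)@g\cdot\langle q\rangle_\ell\Rightarrow\Gamma,\varphi@g\cdot\langle p\rangle_\ell\cdot g'\vdash b$. FwdR: $\Gamma\vdash\varphi@g\cdot\langle p\rangle_\ell\cdot g'$ and $\Gamma\vdash\mathsf{CanRead}(q,\ell)@g\cdot\langle p\rangle_\ell$ and $\Gamma\vdash\mathsf{CanWrite}(p,\ell)@g\cdot\langle q\rangle_\ell\Rightarrow\Gamma\vdash\varphi@g\cdot\langle q\rangle_\ell\cdot g'$. - FlowsToRefl: $\Gamma\vdash(\ell\sqsubseteq\ell)@g$. FlowsToTrans: $\Gamma\vdash(\ell_1\sqsubseteq\ell_2)@g$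 and $\Gamma\vdash(\ell_2\sqsubseteq\ell_3)@g\Rightarrow\Gamma\vdash(\ell_1\sqsubseteq\ell_3)@g$. CRVar: $\Gamma\vdash\mathsf{CanRead}(p,\ell_2)@g$ and $\Gamma\vdash(\ell_1\sqsubseteq\ell_2)@g\Rightarrow\Gamma\vdash\mathsf{CanRead}(p,\ell_1)@g$. CWVar: $\Gamma\vdash\mathsf{CanWrite}(p,\ell_1)@g$ and $\Gamma\vdash(\ell_1\sqsubseteq\ell_2)@g\Rightarrow\Gamma\vdash\mathsf{CanWrite}(p,\ell_2)@g$. *Claim.* Let Cut be the rule $$\frac{\Gamma\vdash\varphi@g_1\qquad\Gamma,\varphi@g_1\vdash\psi@g_2}{\Gamma\vdash\psi@g_2}.$$ Every sequent derivable by the rules above together with Cut (used any number of times) is derivable by the rules above alone. In particular, whenever $\Gamma\vdash\varphi@g_1$ and $\Gamma,\varphi@g_1\vdash\psi@g_2$ are derivable without Cut, so is $\Gamma\vdash\psi@g_2$. -/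

import Mathlib

namespace FLAFOL

universe u v w

/-- The data over which FLAFOL is parameterized: a set of sorts containing `Label` and `Principal`,
typed function symbols (constants are the nullary ones), and typed relation symbols.
`Rel` lists the relation symbols *other than* the three compulsory ones (flows-to, `CanRead`,
`CanWrite`), which are primitive in `Formula` below. -/
structure Signature where
  Srt : Type u
  label : Srt
  principal : Srt
  label_ne_principal : label ≠ principal
  Fn : Type v
  dom : Fn → List Srt
  cod : Fn → Srt
  Rel : Type w
  relDom : Rel → List Srt

/-- Variables of sort `τ` below binders of sorts `Θ` (innermost first): a bound variable, or one of
the countably many free variables `x₀, x₁, …` of sort `τ`. In particular `Var S [] τ` is the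
infinite set of free variables of sort `τ`. Bound variables being positions, formulae
are automatically identified up to renaming of bound variables. -/
inductive Var (S : Signature.{u, v, w}) : List S.Srt → S.Srt → Type u
  | free {τ : S.Srt} (n : ℕ) : Var S [] τ
  | here {Θ : List S.Srt} {τ : S.Srt} : Var S (τ :: Θ) τ
  | there {Θ : List S.Srt} {σ τ : S.Srt} (y : Var S Θ τ) : Var S (σ :: Θ) τ

/-- `τ`-terms `x | f(t₁, …, tₙ)` below binders of sorts `Θ`. -/
inductive Term (S : Signature.{u, v, w}) (Θ : List S.Srt) : S.Srt → Type (max u v)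
  | var {τ : S.Srt} (x : Var S Θ τ) : Term S Θ τ
  | app (f : S.Fn) (ts : ∀ i : Fin (S.dom f).length, Term S Θ ((S.dom f).get i)) :
      Term S Θ (S.cod f)

/-- Formulae below binders of sorts `Θ`; the formulae of the logic are those with `Θ = []`. -/
inductive Formula (S : Signature.{u, v, w}) : List S.Srt → Type (max u v w)
  | rel {Θ : List S.Srt} (R : S.Rel)
      (ts : ∀ i : Fin (S.relDom R).length, Term S Θ ((S.relDom R).get i)) : Formula S Θ
  | flowsTo {Θ : List S.Srt} (l l' : Term S Θ S.label) : Formula S Θ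
  | canRead {Θ : List S.Srt} (p : Term S Θ S.principal) (l : Term S Θ S.label) : Formula S Θ
  | canWrite {Θ : List S.Srt} (p : Term S Θ S.principal) (l : Term S Θ S.label) : Formula S Θ
  | tru {Θ : List S.Srt} : Formula S Θ
  | fls {Θ : List S.Srt} : Formula S Θ
  | and {Θ : List S.Srt} (φ ψ : Formula S Θ) : Formula S Θ
  | or {Θ : List S.Srt} (φ ψ : Formula S Θ) : Formula S Θ
  | imp {Θ : List S.Srt} (φ ψ : Formula S Θ) : Formula S Θ
  | all {Θ : List S.Srt} (σ : S.Srt) (φ : Formula S (σ :: Θ)) : Formula S Θ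
  | ex {Θ : List S.Srt} (σ : S.Srt) (φ : Formula S (σ :: Θ)) : Formula S Θ
  | say {Θ : List S.Srt} (p : Term S Θ S.principal) (l : Term S Θ S.label)
      (φ : Formula S Θ) : Formula S Θ

variable {S : Signature.{u, v, w}}

/-- Simultaneous renaming of variables in a term. -/
def Term.rename {Θ Θ' : List S.Srt} (ρ : ∀ τ, Var S Θ τ → Var S Θ' τ) :
    ∀ {τ : S.Srt}, Term S Θ τ → Term S Θ' τ
  | _, .var x => .var (ρ _ x)
  | _, .app f ts => .app f (fun i => (ts i).rename ρ)

/-- Simultaneous substitution of terms for variables in a term. -/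
def Term.subst {Θ Θ' : List S.Srt} (ρ : ∀ τ, Var S Θ τ → Term S Θ' τ) :
    ∀ {τ : S.Srt}, Term S Θ τ → Term S Θ' τ
  | _, .var x => ρ _ x
  | _, .app f ts => .app f (fun i => (ts i).subst ρ)

/-- Passing a substitution below one more binder. -/
def liftSubst {Θ Θ' : List S.Srt} (ρ : ∀ τ, Var S Θ τ → Term S Θ' τ) (σ : S.Srt) :
    ∀ τ, Var S (σ :: Θ) τ → Term S (σ :: Θ') τ
  | _, .here => .var .here
  | _, .there y => (ρ _ y).rename (fun _ => Var.there)

/-- Simultaneous (capture-avoiding) substitution of terms for variables in a formula. -/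
def Formula.subst : ∀ {Θ Θ' : List S.Srt}, (∀ τ, Var S Θ τ → Term S Θ' τ) →
    Formula S Θ → Formula S Θ'
  | _, _, ρ, .rel R ts => .rel R (fun i => (ts i).subst ρ)
  | _, _, ρ, .flowsTo l l' => .flowsTo (l.subst ρ) (l'.subst ρ)
  | _, _, ρ, .canRead p l => .canRead (p.subst ρ) (l.subst ρ)
  | _, _, ρ, .canWrite p l => .canWrite (p.subst ρ) (l.subst ρ)
  | _, _, _, .tru => .tru
  | _, _, _, .fls => .fls
  | _, _, ρ, .and φ ψ => .and (φ.subst ρ) (ψ.subst ρ)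
  | _, _, ρ, .or φ ψ => .or (φ.subst ρ) (ψ.subst ρ)
  | _, _, ρ, .imp φ ψ => .imp (φ.subst ρ) (ψ.subst ρ)
  | _, _, ρ, .all σ φ => .all σ (φ.subst (liftSubst ρ σ))
  | _, _, ρ, .ex σ φ => .ex σ (φ.subst (liftSubst ρ σ))
  | _, _, ρ, .say p l φ => .say (p.subst ρ) (l.subst ρ) (φ.subst ρ)

/-- The substitution replacing the outermost bound variable by `t`, fixing everything else. -/
def instSubst {Θ : List S.Srt} {σ : S.Srt} (t : Term S Θ σ) :
    ∀ τ, Var S (σ :: Θ) τ → Term S Θ τ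
  | _, .here => t
  | _, .there y => .var y

/-- `φ[x ↦ t]` for the body `φ` of a quantified formula `∀ x : σ. φ` or `∃ x : σ. φ`. -/
def Formula.inst {Θ : List S.Srt} {σ : S.Srt} (φ : Formula S (σ :: Θ)) (t : Term S Θ σ) :
    Formula S Θ :=
  φ.subst (instSubst t)

/-- `x` occurs in the term. -/
def Term.Occurs {Θ : List S.Srt} {σ : S.Srt} (x : Var S Θ σ) : ∀ {τ : S.Srt}, Term S Θ τ → Prop
  | τ, .var y => (⟨σ, x⟩ : Σ τ, Var S Θ τ) = ⟨τ, y⟩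
  | _, .app _ ts => ∃ i, (ts i).Occurs x

/-- `x` occurs in the formula (and is not bound in it). -/
def Formula.Occurs {σ : S.Srt} : ∀ {Θ : List S.Srt}, Var S Θ σ → Formula S Θ → Prop
  | _, x, .rel _ ts => ∃ i, (ts i).Occurs x
  | _, x, .flowsTo l l' => l.Occurs x ∨ l'.Occurs x
  | _, x, .canRead p l => p.Occurs x ∨ l.Occurs x
  | _, x, .canWrite p l => p.Occurs x ∨ l.Occurs x
  | _, _, .tru => False
  | _, _, .fls => False
  | _, x, .and φ ψ => φ.Occurs x ∨ ψ.Occurs x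
  | _, x, .or φ ψ => φ.Occurs x ∨ ψ.Occurs x
  | _, x, .imp φ ψ => φ.Occurs x ∨ ψ.Occurs x
  | _, x, .all _ φ => φ.Occurs (.there x)
  | _, x, .ex _ φ => φ.Occurs (.there x)
  | _, x, .say p l φ => p.Occurs x ∨ l.Occurs x ∨ φ.Occurs x

/-- Generalized principals: stacks of principal/label pairs, the bottom of the stack first.
`[]` is ground truth, and `g ++ [(p, l)]` is `g · ⟨p⟩_l`. -/
abbrev GPrincipal (S : Signature.{u, v, w}) : Type (max u v) :=
  List (Term S [] S.principal × Term S [] S.label)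

/-- `x` occurs free in the generalized principal. -/
def GPrincipal.Occurs {σ : S.Srt} (x : Var S [] σ) (g : GPrincipal S) : Prop :=
  ∃ m ∈ g, m.1.Occurs x ∨ m.2.Occurs x

/-- A belief `φ @ g`. -/
structure Belief (S : Signature.{u, v, w}) where
  formula : Formula S []
  gp : GPrincipal S

/-- `x` occurs free in the belief. -/
def Belief.Occurs {σ : S.Srt} (x : Var S [] σ) (b : Belief S) : Prop :=
  b.formula.Occurs x ∨ GPrincipal.Occurs x b.gp

/-- Contexts; `Γ, b` is written `b :: Γ`. -/
abbrev Ctx (S : Signature.{u, v, w}) : Type (max u v w) := List (Belief S)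

/-- `x` occurs free in the context. -/
def Ctx.Occurs {σ : S.Srt} (x : Var S [] σ) (Γ : Ctx S) : Prop :=
  ∃ b ∈ Γ, b.Occurs x

/-- A sequent `Γ ⊢ b`. -/
structure Sequent (S : Signature.{u, v, w}) where
  ctx : Ctx S
  goal : Belief S

/-- An inference rule, as the relation between the lists of premises and the conclusions of
its instances. -/
abbrev Rule (S : Signature.{u, v, w}) : Type (max u v w) := List (Sequent S) → Sequent S → Prop

/-- `ProvesWith X Γ b`: the sequent `Γ ⊢ b` has a derivation by the rules of FLAFOL together with
the additional rule `X` (constructor `extra`). -/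
inductive ProvesWith (X : Rule S) : Ctx S → Belief S → Prop
  | extra {premises : List (Sequent S)} {s : Sequent S} (hX : X premises s)
      (h : ∀ s' ∈ premises, ProvesWith X s'.ctx s'.goal) :
      ProvesWith X s.ctx s.goal
  | ax {Γ : Ctx S} {φ : Formula S []} {g : GPrincipal S} :
      ProvesWith X (⟨φ, g⟩ :: Γ) ⟨φ, g⟩
  -- structural rules
  | weakening {Γ : Ctx S} {a b : Belief S} (h : ProvesWith X Γ b) :
      ProvesWith X (a :: Γ) b
  | contraction {Γ : Ctx S} {a b : Belief S} (h : ProvesWith X (a :: a :: Γ) b) :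
      ProvesWith X (a :: Γ) b
  | exchange {Γ Γ' : Ctx S} {a₁ a₂ b : Belief S} (h : ProvesWith X (Γ' ++ a₂ :: a₁ :: Γ) b) :
      ProvesWith X (Γ' ++ a₁ :: a₂ :: Γ) b
  -- propositional connectives
  | falseL {Γ : Ctx S} {φ : Formula S []} {g g' : GPrincipal S} :
      ProvesWith X (⟨.fls, g⟩ :: Γ) ⟨φ, g ++ g'⟩
  | trueR {Γ : Ctx S} {g : GPrincipal S} :
      ProvesWith X Γ ⟨.tru, g⟩
  | andL {Γ : Ctx S} {φ ψ : Formula S []} {g : GPrincipal S} {b : Belief S}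
      (h : ProvesWith X (⟨ψ, g⟩ :: ⟨φ, g⟩ :: Γ) b) :
      ProvesWith X (⟨.and φ ψ, g⟩ :: Γ) b
  | andR {Γ : Ctx S} {φ ψ : Formula S []} {g : GPrincipal S}
      (h₁ : ProvesWith X Γ ⟨φ, g⟩) (h₂ : ProvesWith X Γ ⟨ψ, g⟩) :
      ProvesWith X Γ ⟨.and φ ψ, g⟩
  | orL {Γ : Ctx S} {φ ψ : Formula S []} {g : GPrincipal S} {b : Belief S}
      (h₁ : ProvesWith X (⟨φ, g⟩ :: Γ) b) (h₂ : ProvesWith X (⟨ψ, g⟩ :: Γ) b) :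
      ProvesWith X (⟨.or φ ψ, g⟩ :: Γ) b
  | orR1 {Γ : Ctx S} {φ ψ : Formula S []} {g : GPrincipal S} (h : ProvesWith X Γ ⟨φ, g⟩) :
      ProvesWith X Γ ⟨.or φ ψ, g⟩
  | orR2 {Γ : Ctx S} {φ ψ : Formula S []} {g : GPrincipal S} (h : ProvesWith X Γ ⟨ψ, g⟩) :
      ProvesWith X Γ ⟨.or φ ψ, g⟩
  | impL {Γ : Ctx S} {φ ψ : Formula S []} {g : GPrincipal S} {b : Belief S}
      (h₁ : ProvesWith X Γ ⟨φ, []⟩) (h₂ : ProvesWith X (⟨ψ, g⟩ :: Γ) b) :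
      ProvesWith X (⟨.imp φ ψ, g⟩ :: Γ) b
  | impR {Γ : Ctx S} {φ ψ : Formula S []} {g : GPrincipal S}
      (h : ProvesWith X (⟨φ, []⟩ :: Γ) ⟨ψ, g⟩) :
      ProvesWith X Γ ⟨.imp φ ψ, g⟩
  -- quantifiers; in `forallR` and `existsL`, `x` is the eigenvariable
  | forallL {Γ : Ctx S} {σ : S.Srt} {φ : Formula S [σ]} {g : GPrincipal S} {b : Belief S}
      (t : Term S [] σ) (h : ProvesWith X (⟨φ.inst t, g⟩ :: Γ) b) :
      ProvesWith X (⟨.all σ φ, g⟩ :: Γ) b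
  | forallR {Γ : Ctx S} {σ : S.Srt} {φ : Formula S [σ]} {g : GPrincipal S} (x : Var S [] σ)
      (hΓ : ¬ Ctx.Occurs x Γ) (hg : ¬ GPrincipal.Occurs x g) (hφ : ¬ (Formula.all σ φ).Occurs x)
      (h : ProvesWith X Γ ⟨φ.inst (.var x), g⟩) :
      ProvesWith X Γ ⟨.all σ φ, g⟩
  | existsL {Γ : Ctx S} {σ : S.Srt} {φ : Formula S [σ]} {g : GPrincipal S} {b : Belief S}
      (x : Var S [] σ)
      (hΓ : ¬ Ctx.Occurs x Γ) (hg : ¬ GPrincipal.Occurs x g) (hφ : ¬ (Formula.ex σ φ).Occurs x)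
      (hb : ¬ b.Occurs x) (h : ProvesWith X (⟨φ.inst (.var x), g⟩ :: Γ) b) :
      ProvesWith X (⟨.ex σ φ, g⟩ :: Γ) b
  | existsR {Γ : Ctx S} {σ : S.Srt} {φ : Formula S [σ]} {g : GPrincipal S}
      (t : Term S [] σ) (h : ProvesWith X Γ ⟨φ.inst t, g⟩) :
      ProvesWith X Γ ⟨.ex σ φ, g⟩
  -- `says`
  | saysL {Γ : Ctx S} {φ : Formula S []} {p : Term S [] S.principal} {l : Term S [] S.label}
      {g : GPrincipal S} {b : Belief S} (h : ProvesWith X (⟨φ, g ++ [(p, l)]⟩ :: Γ) b) :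
      ProvesWith X (⟨.say p l φ, g⟩ :: Γ) b
  | saysR {Γ : Ctx S} {φ : Formula S []} {p : Term S [] S.principal} {l : Term S [] S.label}
      {g : GPrincipal S} (h : ProvesWith X Γ ⟨φ, g ++ [(p, l)]⟩) :
      ProvesWith X Γ ⟨.say p l φ, g⟩
  -- introspection (each rule may be used in both directions)
  | selfL {Γ : Ctx S} {φ : Formula S []} {p : Term S [] S.principal} {l : Term S [] S.label}
      {g g' : GPrincipal S} {b : Belief S} (h : ProvesWith X (⟨φ, g ++ (p, l) :: g'⟩ :: Γ) b) :
      ProvesWith X (⟨φ, g ++ (p, l) :: (p, l) :: g'⟩ :: Γ) b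
  | selfLInv {Γ : Ctx S} {φ : Formula S []} {p : Term S [] S.principal} {l : Term S [] S.label}
      {g g' : GPrincipal S} {b : Belief S}
      (h : ProvesWith X (⟨φ, g ++ (p, l) :: (p, l) :: g'⟩ :: Γ) b) :
      ProvesWith X (⟨φ, g ++ (p, l) :: g'⟩ :: Γ) b
  | selfR {Γ : Ctx S} {φ : Formula S []} {p : Term S [] S.principal} {l : Term S [] S.label}
      {g g' : GPrincipal S} (h : ProvesWith X Γ ⟨φ, g ++ (p, l) :: g'⟩) :
      ProvesWith X Γ ⟨φ, g ++ (p, l) :: (p, l) :: g'⟩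
  | selfRInv {Γ : Ctx S} {φ : Formula S []} {p : Term S [] S.principal} {l : Term S [] S.label}
      {g g' : GPrincipal S} (h : ProvesWith X Γ ⟨φ, g ++ (p, l) :: (p, l) :: g'⟩) :
      ProvesWith X Γ ⟨φ, g ++ (p, l) :: g'⟩
  -- communication: label variance and forwarding
  | varL {Γ : Ctx S} {φ : Formula S []} {p : Term S [] S.principal} {l l' : Term S [] S.label}
      {g g' : GPrincipal S} {b : Belief S}
      (h₁ : ProvesWith X (⟨φ, g ++ (p, l') :: g'⟩ :: Γ) b)
      (h₂ : ProvesWith X (⟨φ, g ++ (p, l) :: g'⟩ :: Γ) ⟨.flowsTo l l', g ++ [(p, l')]⟩) :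
      ProvesWith X (⟨φ, g ++ (p, l) :: g'⟩ :: Γ) b
  | varR {Γ : Ctx S} {φ : Formula S []} {p : Term S [] S.principal} {l l' : Term S [] S.label}
      {g g' : GPrincipal S}
      (h₁ : ProvesWith X Γ ⟨φ, g ++ (p, l') :: g'⟩)
      (h₂ : ProvesWith X Γ ⟨.flowsTo l' l, g ++ [(p, l)]⟩) :
      ProvesWith X Γ ⟨φ, g ++ (p, l) :: g'⟩
  | fwdL {Γ : Ctx S} {φ : Formula S []} {p q : Term S [] S.principal} {l : Term S [] S.label}
      {g g' : GPrincipal S} {b : Belief S}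
      (h₁ : ProvesWith X (⟨φ, g ++ (q, l) :: g'⟩ :: Γ) b)
      (h₂ : ProvesWith X (⟨φ, g ++ (p, l) :: g'⟩ :: Γ) ⟨.canRead q l, g ++ [(p, l)]⟩)
      (h₃ : ProvesWith X (⟨φ, g ++ (p, l) :: g'⟩ :: Γ) ⟨.canWrite p l, g ++ [(q, l)]⟩) :
      ProvesWith X (⟨φ, g ++ (p, l) :: g'⟩ :: Γ) b
  | fwdR {Γ : Ctx S} {φ : Formula S []} {p q : Term S [] S.principal} {l : Term S [] S.label}
      {g g' : GPrincipal S}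
      (h₁ : ProvesWith X Γ ⟨φ, g ++ (p, l) :: g'⟩)
      (h₂ : ProvesWith X Γ ⟨.canRead q l, g ++ [(p, l)]⟩)
      (h₃ : ProvesWith X Γ ⟨.canWrite p l, g ++ [(q, l)]⟩) :
      ProvesWith X Γ ⟨φ, g ++ (q, l) :: g'⟩
  -- permissions
  | flowsToRefl {Γ : Ctx S} {l : Term S [] S.label} {g : GPrincipal S} :
      ProvesWith X Γ ⟨.flowsTo l l, g⟩
  | flowsToTrans {Γ : Ctx S} {l₁ l₂ l₃ : Term S [] S.label} {g : GPrincipal S}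
      (h₁ : ProvesWith X Γ ⟨.flowsTo l₁ l₂, g⟩) (h₂ : ProvesWith X Γ ⟨.flowsTo l₂ l₃, g⟩) :
      ProvesWith X Γ ⟨.flowsTo l₁ l₃, g⟩
  | crVar {Γ : Ctx S} {p : Term S [] S.principal} {l₁ l₂ : Term S [] S.label} {g : GPrincipal S}
      (h₁ : ProvesWith X Γ ⟨.canRead p l₂, g⟩) (h₂ : ProvesWith X Γ ⟨.flowsTo l₁ l₂, g⟩) :
      ProvesWith X Γ ⟨.canRead p l₁, g⟩
  | cwVar {Γ : Ctx S} {p : Term S [] S.principal} {l₁ l₂ : Term S [] S.label} {g : GPrincipal S}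
      (h₁ : ProvesWith X Γ ⟨.canWrite p l₁, g⟩) (h₂ : ProvesWith X Γ ⟨.flowsTo l₁ l₂, g⟩) :
      ProvesWith X Γ ⟨.canWrite p l₂, g⟩

/-- The rule without instances. -/
def noRule (S : Signature.{u, v, w}) : Rule S := fun _ _ => False

/-- Derivability `Γ ⊢ b` in FLAFOL itself (which has no cut rule). -/
abbrev Proves (Γ : Ctx S) (b : Belief S) : Prop := ProvesWith (noRule S) Γ b

/-- A rule is admissible in FLAFOL if every sequent that is derivable using the rule
(any number of times, anywhere in the derivation) is derivable without it. -/
def Admissible (X : Rule S) : Prop :=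
  ∀ (Γ : Ctx S) (b : Belief S), ProvesWith X Γ b → Proves Γ b

/-- The cut rule: from `Γ ⊢ φ @ g₁` and `Γ, φ @ g₁ ⊢ ψ @ g₂` infer `Γ ⊢ ψ @ g₂`. -/
inductive CutRule (S : Signature.{u, v, w}) : Rule S
  | cut (Γ : Ctx S) (φ ψ : Formula S []) (g₁ g₂ : GPrincipal S) :
      CutRule S [⟨Γ, ⟨φ, g₁⟩⟩, ⟨⟨φ, g₁⟩ :: Γ, ⟨ψ, g₂⟩⟩] ⟨Γ, ⟨ψ, g₂⟩⟩

end FLAFOL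

namespace FLAFOL

universe u v w

variable {S : Signature.{u, v, w}}

/-! ### Structural rules -/

/-! Cut elimination is proved semantically, by a model built from cut-free provability. Its worlds
are contexts ordered by inclusion, and a formula at a stack `g` denotes the set of contexts that
force it. Atoms are forced where they are cut-free provable. Disjunctions and existentials are
closed off by `Covered`, so that a context counts as soon as every goal can be proved there by
cases.

Two facts carry the proof. By `ProvesWith.sound`, every derivation, even with cut, preserves
forcing; cut itself is mere composition of two semantic entailments. By
`Formula.forced_of_mem_and_proves`, a context forces each of its own beliefs and proves cut-free
whatever it forces. Evaluating a derivation of `b` from `Γ` at the world `Γ`, under the identity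
assignment, therefore returns a cut-free derivation.

The rules that alter a stack are handled by `Formula.Forced.transport`: if provability moves from `g
++ k` to `h ++ k` for all `k`, so does forcing. This works because the antecedent of an implication
is always read at the empty stack, so no stack ever occurs contravariantly. The right rules alone
supply the transport, and they validate the left rules too, since a left rule merely needs its
changed hypothesis to be forced. -/

theorem ProvesWith.perm {X : Rule S} {Γ Δ : Ctx S} {b : Belief S} (hp : Γ.Perm Δ) :
    ∀ Γ' : Ctx S, ProvesWith X (Γ' ++ Γ) b → ProvesWith X (Γ' ++ Δ) b := by
  induction hp with
  | nil => exact fun _ h => h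
  | cons a _ ih =>
    intro Γ' h
    have := ih (Γ' ++ [a]) (by simpa using h)
    simpa using this
  | swap a c Γ => exact fun Γ' h => .exchange h
  | trans _ _ ih₁ ih₂ => exact fun Γ' h => ih₂ Γ' (ih₁ Γ' h)

theorem ProvesWith.append_left {X : Rule S} {Γ : Ctx S} {b : Belief S} (h : ProvesWith X Γ b) :
    ∀ Δ : Ctx S, ProvesWith X (Δ ++ Γ) b
  | [] => h
  | _ :: Δ => .weakening (h.append_left Δ)

/-- Left rules act on a belief at the head of the context and may consume it. Applying them to an
extra copy and contracting it away lets them act on any member without loss. -/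
theorem ProvesWith.absorb {X : Rule S} {Δ : Ctx S} {b : Belief S} {a : Belief S} (ha : a ∈ Δ)
    (h : ProvesWith X (a :: Δ) b) : ProvesWith X Δ b := by
  obtain ⟨Δ₁, Δ₂, rfl⟩ := List.append_of_mem ha
  have hp : (Δ₁ ++ a :: Δ₂).Perm (a :: (Δ₁ ++ Δ₂)) := List.perm_middle
  exact ProvesWith.perm hp.symm [] (.contraction (ProvesWith.perm hp [a] h))

theorem ProvesWith.absorb_append {X : Rule S} {Δ : Ctx S} {b : Belief S} :
    ∀ {Γ : Ctx S}, Γ ⊆ Δ → ProvesWith X (Γ ++ Δ) b → ProvesWith X Δ b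
  | [], _, h => h
  | a :: Γ, hs, h =>
    absorb_append (fun _ hc => hs (List.mem_cons_of_mem a hc))
      (h.absorb (List.mem_append_right Γ (hs List.mem_cons_self)))

/-- The structural rules make derivability depend only on the set of beliefs, which is why inclusion
can serve as the order on worlds. -/
theorem ProvesWith.mono {X : Rule S} {Γ Δ : Ctx S} {b : Belief S} (h : ProvesWith X Γ b)
    (hs : Γ ⊆ Δ) : ProvesWith X Δ b :=
  .absorb_append hs (.perm List.perm_append_comm [] (h.append_left Δ))

/-! ### Substitution -/

theorem Term.subst_rename {Θ₁ Θ₂ Θ₃ : List S.Srt} (r : ∀ τ, Var S Θ₁ τ → Var S Θ₂ τ)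
    (ρ : ∀ τ, Var S Θ₂ τ → Term S Θ₃ τ) {τ : S.Srt} (t : Term S Θ₁ τ) :
    (t.rename r).subst ρ = t.subst (fun τ x => ρ τ (r τ x)) := by
  induction t with
  | var x => rfl
  | app f ts ih => simp only [Term.rename, Term.subst, ih]

theorem Term.rename_subst {Θ₁ Θ₂ Θ₃ : List S.Srt} (ρ : ∀ τ, Var S Θ₁ τ → Term S Θ₂ τ)
    (r : ∀ τ, Var S Θ₂ τ → Var S Θ₃ τ) {τ : S.Srt} (t : Term S Θ₁ τ) :
    (t.subst ρ).rename r = t.subst (fun τ x => (ρ τ x).rename r) := by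
  induction t with
  | var x => rfl
  | app f ts ih => simp only [Term.rename, Term.subst, ih]

theorem Term.subst_subst {Θ₁ Θ₂ Θ₃ : List S.Srt} (ρ : ∀ τ, Var S Θ₁ τ → Term S Θ₂ τ)
    (ρ' : ∀ τ, Var S Θ₂ τ → Term S Θ₃ τ) {τ : S.Srt} (t : Term S Θ₁ τ) :
    (t.subst ρ).subst ρ' = t.subst (fun τ x => (ρ τ x).subst ρ') := by
  induction t with
  | var x => rfl
  | app f ts ih => simp only [Term.subst, ih]

theorem Term.subst_var {Θ : List S.Srt} {τ : S.Srt} (t : Term S Θ τ) :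
    t.subst (fun _ x => .var x) = t := by
  induction t with
  | var x => rfl
  | app f ts ih => simp only [Term.subst, ih]

theorem Term.subst_congr {Θ Θ' : List S.Srt} {ρ ρ' : ∀ τ, Var S Θ τ → Term S Θ' τ} {τ : S.Srt}
    {t : Term S Θ τ} (h : ∀ σ (x : Var S Θ σ), t.Occurs x → ρ σ x = ρ' σ x) :
    t.subst ρ = t.subst ρ' := by
  induction t with
  | var x => exact h _ x rfl
  | app f ts ih =>
    simp only [Term.subst]
    congr 1
    funext i
    exact ih i fun σ x hx => h σ x ⟨i, hx⟩

theorem liftSubst_comp {Θ₁ Θ₂ Θ₃ : List S.Srt} (ρ : ∀ τ, Var S Θ₁ τ → Term S Θ₂ τ)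
    (ρ' : ∀ τ, Var S Θ₂ τ → Term S Θ₃ τ) (σ : S.Srt) :
    (fun τ x => (liftSubst ρ σ τ x).subst (liftSubst ρ' σ)) =
      liftSubst (fun τ x => (ρ τ x).subst ρ') σ := by
  funext τ x
  cases x with
  | here => rfl
  | there y => simp only [liftSubst, Term.subst_rename, Term.rename_subst]

theorem liftSubst_var (Θ : List S.Srt) (σ : S.Srt) :
    liftSubst (fun _ (x : Var S Θ _) => .var x) σ = fun _ x => .var x := by
  funext τ x
  cases x <;> rfl

theorem Formula.subst_subst {Θ₁ Θ₂ Θ₃ : List S.Srt} (ρ : ∀ τ, Var S Θ₁ τ → Term S Θ₂ τ)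
    (ρ' : ∀ τ, Var S Θ₂ τ → Term S Θ₃ τ) (φ : Formula S Θ₁) :
    (φ.subst ρ).subst ρ' = φ.subst (fun τ x => (ρ τ x).subst ρ') := by
  induction φ generalizing Θ₂ Θ₃ <;>
    simp only [Formula.subst, Term.subst_subst, *, liftSubst_comp]

theorem Formula.subst_var {Θ : List S.Srt} (φ : Formula S Θ) :
    φ.subst (fun _ x => .var x) = φ := by
  induction φ <;> simp only [Formula.subst, Term.subst_var, liftSubst_var, *]

/-- Assignments of closed terms to the variables below binders of sorts `Θ`. -/
abbrev Env (S : Signature.{u, v, w}) (Θ : List S.Srt) : Type (max u v) :=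
  ∀ τ, Var S Θ τ → Term S [] τ

/-- Extension of an assignment by a value for the outermost bound variable. -/
def Env.cons {Θ : List S.Srt} {σ : S.Srt} (t : Term S [] σ) (ρ : Env S Θ) : Env S (σ :: Θ)
  | _, .here => t
  | _, .there y => ρ _ y

theorem Env.cons_liftSubst {Θ Θ' : List S.Srt} {σ : S.Srt} (ρ : ∀ τ, Var S Θ τ → Term S Θ' τ)
    (t : Term S [] σ) (ρ' : Env S Θ') :
    (fun τ x => (liftSubst ρ σ τ x).subst (Env.cons t ρ')) =
      Env.cons t (fun τ x => (ρ τ x).subst ρ') := by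
  funext τ x
  cases x with
  | here => rfl
  | there y => simp only [liftSubst, Term.subst_rename, Env.cons]

theorem Env.cons_instSubst {Θ : List S.Srt} {σ : S.Srt} (t : Term S Θ σ) (ρ : Env S Θ) :
    (fun τ x => (instSubst t τ x).subst ρ) = Env.cons (t.subst ρ) ρ := by
  funext τ x
  cases x <;> rfl

/-- This matches the premises of the quantifier rules with the extended assignments by which
quantifiers are interpreted. -/
theorem Formula.subst_liftSubst_inst {Θ : List S.Srt} {σ : S.Srt} (φ : Formula S (σ :: Θ))
    (ρ : Env S Θ) (t : Term S [] σ) :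
    (φ.subst (liftSubst ρ σ)).inst t = φ.subst (Env.cons t ρ) := by
  rw [Formula.inst, Formula.subst_subst]
  congr 1
  funext τ x
  cases x with
  | here => rfl
  | there y =>
    simp only [liftSubst, Term.subst_rename, Env.cons, instSubst]
    exact Term.subst_var _

/-- Updating over pairs of a sort and a variable avoids casts between terms of different sorts. -/
theorem Env.exists_update (ρ : Env S []) {σ : S.Srt} (x : Var S [] σ) (t : Term S [] σ) :
    ∃ ρ' : Env S [], ρ' σ x = t ∧
      ∀ τ (y : Var S [] τ), (⟨σ, x⟩ : Σ τ, Var S [] τ) ≠ ⟨τ, y⟩ → ρ' τ y = ρ τ y := by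
  classical
  let f : ∀ s : Σ τ, Var S [] τ, Term S [] s.1 :=
    Function.update (fun s => ρ s.1 s.2) ⟨σ, x⟩ t
  refine ⟨fun τ y => f ⟨τ, y⟩, Function.update_self _ _ _, fun τ y h => ?_⟩
  exact Function.update_of_ne h.symm _ _

/-! ### Fresh variables -/

/-- The free variable `xₙ` of sort `σ`, seen below binders of sorts `Θ`. -/
def Var.freeBelow (σ : S.Srt) : ∀ Θ : List S.Srt, ℕ → Var S Θ σ
  | [], n => .free n
  | _ :: Θ, n => .there (freeBelow σ Θ n)

theorem Var.freeBelow_injective (σ : S.Srt) :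
    ∀ Θ : List S.Srt, Function.Injective (Var.freeBelow σ Θ)
  | [], _, _, h => by simpa [Var.freeBelow] using h
  | _ :: Θ, _, _, h => freeBelow_injective σ Θ (by simpa [Var.freeBelow] using h)

theorem Term.finite_occurs {Θ : List S.Srt} (σ : S.Srt) {τ : S.Srt} (t : Term S Θ τ) :
    {n | t.Occurs (Var.freeBelow σ Θ n)}.Finite := by
  induction t with
  | @var τ x =>
    refine Set.Subsingleton.finite fun m hm n hn => ?_
    have h : (⟨σ, Var.freeBelow σ Θ m⟩ : Σ τ, Var S Θ τ) = ⟨σ, Var.freeBelow σ Θ n⟩ :=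
      Eq.trans (show _ = (⟨τ, x⟩ : Σ τ, Var S Θ τ) from hm) (Eq.symm hn)
    exact Var.freeBelow_injective σ Θ (by simpa using h)
  | app f ts ih =>
    simp only [Term.Occurs, Set.ofPred_exists]
    exact Set.finite_iUnion ih

/-- Under a binder `Var.freeBelow` unfolds to `Var.there`, just as `Formula.Occurs` does, so the
quantifier cases are the induction hypothesis itself. -/
theorem Formula.finite_occurs {Θ : List S.Srt} (σ : S.Srt) (φ : Formula S Θ) :
    {n | φ.Occurs (Var.freeBelow σ Θ n)}.Finite := by
  induction φ with
  | rel R ts =>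
    simp only [Formula.Occurs, Set.ofPred_exists]
    exact Set.finite_iUnion fun i => (ts i).finite_occurs σ
  | flowsTo l l' => exact (l.finite_occurs σ).union (l'.finite_occurs σ)
  | canRead p l => exact (p.finite_occurs σ).union (l.finite_occurs σ)
  | canWrite p l => exact (p.finite_occurs σ).union (l.finite_occurs σ)
  | tru => exact Set.finite_empty
  | fls => exact Set.finite_empty
  | and φ ψ ih₁ ih₂ => exact ih₁.union ih₂
  | or φ ψ ih₁ ih₂ => exact ih₁.union ih₂
  | imp φ ψ ih₁ ih₂ => exact ih₁.union ih₂
  | all τ φ ih => exact ih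
  | ex τ φ ih => exact ih
  | say p l φ ih => exact (p.finite_occurs σ).union ((l.finite_occurs σ).union ih)

theorem GPrincipal.finite_occurs (σ : S.Srt) (g : GPrincipal S) :
    {n | GPrincipal.Occurs (Var.free n : Var S [] σ) g}.Finite := by
  have : {n | GPrincipal.Occurs (Var.free n : Var S [] σ) g} =
      ⋃ m ∈ {m | m ∈ g}, {n | m.1.Occurs (Var.free n : Var S [] σ) ∨
        m.2.Occurs (Var.free n : Var S [] σ)} := by
    ext n
    simp [GPrincipal.Occurs]
  rw [this]
  exact (List.finite_toSet g).biUnion fun m _ =>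
    (m.1.finite_occurs σ).union (m.2.finite_occurs σ)

theorem Belief.finite_occurs (σ : S.Srt) (b : Belief S) :
    {n | b.Occurs (Var.free n : Var S [] σ)}.Finite :=
  (b.formula.finite_occurs σ).union (GPrincipal.finite_occurs σ b.gp)

theorem Ctx.exists_fresh (σ : S.Srt) (Γ : Ctx S) : ∃ x : Var S [] σ, ¬ Ctx.Occurs x Γ := by
  have : {n | Ctx.Occurs (Var.free n : Var S [] σ) Γ} =
      ⋃ b ∈ {b | b ∈ Γ}, {n | b.Occurs (Var.free n : Var S [] σ)} := by
    ext n
    simp [Ctx.Occurs]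
  have hfin : {n | Ctx.Occurs (Var.free n : Var S [] σ) Γ}.Finite := by
    rw [this]
    exact (List.finite_toSet Γ).biUnion fun b _ => b.finite_occurs σ
  obtain ⟨n, hn⟩ := hfin.exists_notMem
  exact ⟨.free n, hn⟩

/-! ### The cut-free model

A formula at a generalized principal denotes a set of contexts, closed under extension of contexts
and under the double-orthogonal closure with respect to cut-free provability. -/

/-- The closure of a set of contexts with respect to cut-free provability. -/
def Covered (P : Ctx S → Prop) (Γ : Ctx S) : Prop :=
  ∀ Δ, Γ ⊆ Δ → ∀ b, (∀ Δ', Δ ⊆ Δ' → P Δ' → Proves Δ' b) → Proves Δ b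

theorem Covered.mono {P : Ctx S → Prop} {Γ Γ' : Ctx S} (h : Covered P Γ) (hs : Γ ⊆ Γ') :
    Covered P Γ' :=
  fun Δ hΔ => h Δ (List.Subset.trans hs hΔ)

/-- `P` need not be monotone, hence the assumption at every extension. -/
theorem Covered.of {P : Ctx S → Prop} {Γ : Ctx S} (hmono : ∀ Δ, Γ ⊆ Δ → P Δ) : Covered P Γ :=
  fun Δ hΔ _ h => h Δ (List.Subset.refl Δ) (hmono Δ hΔ)

theorem Covered.bind {P Q : Ctx S → Prop} {Γ : Ctx S} (h : Covered P Γ)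
    (hPQ : ∀ Δ, Γ ⊆ Δ → P Δ → Covered Q Δ) : Covered Q Γ :=
  fun Δ hΔ b hb => h Δ hΔ b fun Δ' hΔ' hP =>
    hPQ Δ' (List.Subset.trans hΔ hΔ') hP Δ' (List.Subset.refl Δ') b fun Δ'' hs => hb Δ'' (List.Subset.trans hΔ' hs)

theorem Covered.imp {P Q : Ctx S → Prop} {Γ : Ctx S} (h : Covered P Γ)
    (hPQ : ∀ Δ, Γ ⊆ Δ → P Δ → Q Δ) : Covered Q Γ :=
  fun Δ hΔ b hb => h Δ hΔ b fun Δ' hΔ' hP => hb Δ' hΔ' (hPQ Δ' (List.Subset.trans hΔ hΔ') hP)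

theorem Covered.proves {P : Ctx S → Prop} {Γ : Ctx S} {b : Belief S} (h : Covered P Γ)
    (hP : ∀ Δ, Γ ⊆ Δ → P Δ → Proves Δ b) : Proves Γ b :=
  h Γ (List.Subset.refl Γ) b hP

/-- The contexts forcing `φ @ g` under the assignment `ρ`. -/
def Formula.Forced : ∀ {Θ : List S.Srt}, Formula S Θ → Env S Θ → GPrincipal S → Ctx S → Prop
  | _, .rel R ts, ρ, g, Γ => Proves Γ ⟨.rel R (fun i => (ts i).subst ρ), g⟩
  | _, .flowsTo l l', ρ, g, Γ => Proves Γ ⟨.flowsTo (l.subst ρ) (l'.subst ρ), g⟩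
  | _, .canRead p l, ρ, g, Γ => Proves Γ ⟨.canRead (p.subst ρ) (l.subst ρ), g⟩
  | _, .canWrite p l, ρ, g, Γ => Proves Γ ⟨.canWrite (p.subst ρ) (l.subst ρ), g⟩
  | _, .tru, _, _, _ => True
  | _, .fls, _, g, Γ => ∀ χ k, Proves Γ ⟨χ, g ++ k⟩
  | _, .and φ ψ, ρ, g, Γ => φ.Forced ρ g Γ ∧ ψ.Forced ρ g Γ
  | _, .or φ ψ, ρ, g, Γ => Covered (fun Δ => φ.Forced ρ g Δ ∨ ψ.Forced ρ g Δ) Γ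
  | _, .imp φ ψ, ρ, g, Γ => ∀ Δ, Γ ⊆ Δ → φ.Forced ρ [] Δ → ψ.Forced ρ g Δ
  | _, .all _ φ, ρ, g, Γ => ∀ t, φ.Forced (Env.cons t ρ) g Γ
  | _, .ex _ φ, ρ, g, Γ => Covered (fun Δ => ∃ t, φ.Forced (Env.cons t ρ) g Δ) Γ
  | _, .say p l φ, ρ, g, Γ => φ.Forced ρ (g ++ [(p.subst ρ, l.subst ρ)]) Γ

theorem Formula.Forced.mono {Θ : List S.Srt} {φ : Formula S Θ} {ρ : Env S Θ} {g : GPrincipal S}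
    {Γ Δ : Ctx S} (h : φ.Forced ρ g Γ) (hs : Γ ⊆ Δ) : φ.Forced ρ g Δ := by
  induction φ generalizing g with
  | rel R ts => exact ProvesWith.mono h hs
  | flowsTo l l' => exact ProvesWith.mono h hs
  | canRead p l => exact ProvesWith.mono h hs
  | canWrite p l => exact ProvesWith.mono h hs
  | tru => trivial
  | fls => exact fun χ k => (h χ k).mono hs
  | and φ ψ ih₁ ih₂ => exact ⟨ih₁ h.1, ih₂ h.2⟩
  | or φ ψ => exact Covered.mono h hs
  | imp φ ψ => exact fun Δ' hΔ' => h Δ' (List.Subset.trans hs hΔ')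
  | all σ φ ih => exact fun t => ih (h t)
  | ex σ φ => exact Covered.mono h hs
  | say p l φ ih => exact ih (g := g ++ _) h

/-- Every denotation is closed: atoms and falsity because they are defined by provability,
disjunctions and existentials because `Covered` is idempotent, the rest by inheritance. Hence
forcing may be established by applying a left rule towards an arbitrary goal, or by case analysis.
-/
theorem Formula.Forced.of_covered {Θ : List S.Srt} {φ : Formula S Θ} {ρ : Env S Θ}
    {g : GPrincipal S} {Γ : Ctx S} (h : Covered (φ.Forced ρ g) Γ) : φ.Forced ρ g Γ := by
  induction φ generalizing g Γ with
  | rel R ts => exact h.proves fun _ _ hP => hP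
  | flowsTo l l' => exact h.proves fun _ _ hP => hP
  | canRead p l => exact h.proves fun _ _ hP => hP
  | canWrite p l => exact h.proves fun _ _ hP => hP
  | tru => trivial
  | fls => exact fun χ k => h.proves fun _ _ hP => hP χ k
  | and φ ψ ih₁ ih₂ => exact ⟨ih₁ (h.imp fun _ _ hP => hP.1), ih₂ (h.imp fun _ _ hP => hP.2)⟩
  | or φ ψ => exact Covered.bind h fun _ _ hP => hP
  | imp φ ψ _ ih =>
    exact fun Δ hΔ hφ => ih ((h.mono hΔ).imp fun Δ' hs hP =>
      hP Δ' (List.Subset.refl Δ') (hφ.mono hs))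
  | all σ φ ih => exact fun t => ih (h.imp fun _ _ hP => hP t)
  | ex σ φ => exact Covered.bind h fun _ _ hP => hP
  | say p l φ ih => exact ih (g := g ++ _) h

/-- If every cut-free provable belief can be moved from `g · k` to `h · k`, so can every forced
formula. -/
theorem Formula.Forced.transport {Θ : List S.Srt} {φ : Formula S Θ} {ρ : Env S Θ}
    {g h : GPrincipal S} {Γ : Ctx S}
    (H : ∀ Δ, Γ ⊆ Δ → ∀ χ k, Proves Δ ⟨χ, g ++ k⟩ → Proves Δ ⟨χ, h ++ k⟩)
    {k : GPrincipal S} (hφ : φ.Forced ρ (g ++ k) Γ) : φ.Forced ρ (h ++ k) Γ := by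
  induction φ generalizing k Γ with
  | rel R ts => exact H Γ (List.Subset.refl Γ) _ k hφ
  | flowsTo l l' => exact H Γ (List.Subset.refl Γ) _ k hφ
  | canRead p l => exact H Γ (List.Subset.refl Γ) _ k hφ
  | canWrite p l => exact H Γ (List.Subset.refl Γ) _ k hφ
  | tru => trivial
  | fls =>
    intro χ k'
    rw [List.append_assoc]
    exact H Γ (List.Subset.refl Γ) _ (k ++ k') (by rw [← List.append_assoc]; exact hφ χ k')
  | and φ ψ ih₁ ih₂ => exact ⟨ih₁ H hφ.1, ih₂ H hφ.2⟩
  | or φ ψ ih₁ ih₂ =>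
    exact Covered.imp hφ fun Δ hΔ hP =>
      hP.imp (ih₁ fun Δ' hs => H Δ' (List.Subset.trans hΔ hs)) (ih₂ fun Δ' hs => H Δ' (List.Subset.trans hΔ hs))
  -- The antecedent is forced at `[]` on both sides, so only the consequent moves.
  | imp φ ψ _ ih =>
    exact fun Δ hΔ hP => ih (fun Δ' hs => H Δ' (List.Subset.trans hΔ hs)) (hφ Δ hΔ hP)
  | all σ φ ih => exact fun t => ih H (hφ t)
  | ex σ φ ih =>
    exact Covered.imp hφ fun Δ hΔ ⟨t, ht⟩ => ⟨t, ih (fun Δ' hs => H Δ' (List.Subset.trans hΔ hs)) ht⟩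
  | say p l φ ih =>
    simp only [Formula.Forced, List.append_assoc] at hφ ⊢
    exact ih H hφ

/-- The suffix `k` is needed because `says` lengthens the stack; forced falsity yields everything at
all extensions of `g`, hence every atom met on the way down. -/
theorem Formula.forced_of_false {Θ : List S.Srt} (φ : Formula S Θ) {ρ : Env S Θ}
    {g : GPrincipal S} {Γ : Ctx S} (H : ∀ χ k, Proves Γ ⟨χ, g ++ k⟩) (k : GPrincipal S) :
    φ.Forced ρ (g ++ k) Γ := by
  induction φ generalizing k Γ with
  | rel R ts => exact H _ k
  | flowsTo l l' => exact H _ k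
  | canRead p l => exact H _ k
  | canWrite p l => exact H _ k
  | tru => trivial
  | fls => exact fun χ k' => by rw [List.append_assoc]; exact H χ (k ++ k')
  | and φ ψ ih₁ ih₂ => exact ⟨ih₁ H k, ih₂ H k⟩
  | or φ ψ ih _ => exact Covered.of fun Δ hΔ => Or.inl (ih (fun χ k => (H χ k).mono hΔ) k)
  | imp φ ψ _ ih => exact fun Δ hΔ _ => ih (fun χ k => (H χ k).mono hΔ) k
  | all σ φ ih => exact fun t => ih H k
  | ex σ φ ih =>
    exact Covered.of fun Δ hΔ =>
      -- Any witness will do; every sort is inhabited by a variable.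
      ⟨.var (.free 0), ih (fun χ k => (H χ k).mono hΔ) k⟩
  | say p l φ ih =>
    simp only [Formula.Forced, List.append_assoc]
    exact ih H _

theorem Formula.forced_subst {Θ Θ' : List S.Srt} (φ : Formula S Θ)
    (σ : ∀ τ, Var S Θ τ → Term S Θ' τ) (ρ : Env S Θ') :
    (φ.subst σ).Forced ρ = φ.Forced (fun τ x => (σ τ x).subst ρ) := by
  induction φ generalizing Θ' <;> funext g Γ <;>
    simp only [Formula.subst, Formula.Forced, Term.subst_subst, *, Env.cons_liftSubst]

theorem Formula.forced_inst {Θ : List S.Srt} {σ : S.Srt} (φ : Formula S (σ :: Θ)) (t : Term S Θ σ)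
    (ρ : Env S Θ) : (φ.inst t).Forced ρ = φ.Forced (Env.cons (t.subst ρ) ρ) := by
  rw [Formula.inst, Formula.forced_subst, Env.cons_instSubst]

theorem Env.cons_congr {Θ : List S.Srt} {σ : S.Srt} {φ : Formula S (σ :: Θ)} {ρ ρ' : Env S Θ}
    (h : ∀ τ (x : Var S Θ τ), φ.Occurs (.there x) → ρ τ x = ρ' τ x) (t : Term S [] σ) (τ : S.Srt)
    (x : Var S (σ :: Θ) τ) (hx : φ.Occurs x) : Env.cons t ρ τ x = Env.cons t ρ' τ x := by
  cases x with
  | here => rfl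
  | there y => exact h _ y hx

/-- This gives the eigenvariable conditions their force: reassigning a variable that does not occur
changes nothing. -/
theorem Formula.forced_congr {Θ : List S.Srt} {φ : Formula S Θ} {ρ ρ' : Env S Θ}
    (h : ∀ σ (x : Var S Θ σ), φ.Occurs x → ρ σ x = ρ' σ x) : φ.Forced ρ = φ.Forced ρ' := by
  induction φ with
  | rel R ts =>
    have this i : (ts i).subst ρ = (ts i).subst ρ' :=
      Term.subst_congr fun σ x hx => h σ x ⟨i, hx⟩
    funext g Γ
    simp only [Formula.Forced, this]
  | flowsTo l l' =>
    funext g Γ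
    simp only [Formula.Forced, Term.subst_congr fun σ x hx => h σ x (Or.inl hx),
      Term.subst_congr fun σ x hx => h σ x (Or.inr hx)]
  | canRead p l =>
    funext g Γ
    simp only [Formula.Forced, Term.subst_congr fun σ x hx => h σ x (Or.inl hx),
      Term.subst_congr fun σ x hx => h σ x (Or.inr hx)]
  | canWrite p l =>
    funext g Γ
    simp only [Formula.Forced, Term.subst_congr fun σ x hx => h σ x (Or.inl hx),
      Term.subst_congr fun σ x hx => h σ x (Or.inr hx)]
  | tru => rfl
  | fls => rfl
  | and φ ψ ih₁ ih₂ =>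
    funext g Γ
    simp only [Formula.Forced, ih₁ fun σ x hx => h σ x (Or.inl hx),
      ih₂ fun σ x hx => h σ x (Or.inr hx)]
  | or φ ψ ih₁ ih₂ =>
    funext g Γ
    simp only [Formula.Forced, ih₁ fun σ x hx => h σ x (Or.inl hx),
      ih₂ fun σ x hx => h σ x (Or.inr hx)]
  | imp φ ψ ih₁ ih₂ =>
    funext g Γ
    simp only [Formula.Forced, ih₁ fun σ x hx => h σ x (Or.inl hx),
      ih₂ fun σ x hx => h σ x (Or.inr hx)]
  | all σ φ ih =>
    have this t : φ.Forced (Env.cons t ρ) = φ.Forced (Env.cons t ρ') := ih (Env.cons_congr h t)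
    funext g Γ
    simp only [Formula.Forced, this]
  | ex σ φ ih =>
    have this t : φ.Forced (Env.cons t ρ) = φ.Forced (Env.cons t ρ') := ih (Env.cons_congr h t)
    funext g Γ
    simp only [Formula.Forced, this]
  | say p l φ ih =>
    funext g Γ
    simp only [Formula.Forced, Term.subst_congr fun σ x hx => h σ x (Or.inl hx),
      Term.subst_congr fun σ x hx => h σ x (Or.inr (Or.inl hx)),
      ih fun σ x hx => h σ x (Or.inr (Or.inr hx))]

/-! ### Completeness of the model for cut-free provability -/

theorem proves_of_mem {Γ : Ctx S} {φ : Formula S []} {g : GPrincipal S}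
    (h : (⟨φ, g⟩ : Belief S) ∈ Γ) : Proves Γ ⟨φ, g⟩ :=
  (ProvesWith.ax (Γ := Γ)).absorb h

/-- Beliefs in the context are forced, and forced beliefs are cut-free provable. -/
theorem Formula.forced_of_mem_and_proves {Θ : List S.Srt} (φ : Formula S Θ) (ρ : Env S Θ)
    (g : GPrincipal S) (Γ : Ctx S) :
    ((⟨φ.subst ρ, g⟩ : Belief S) ∈ Γ → φ.Forced ρ g Γ) ∧
      (φ.Forced ρ g Γ → Proves Γ ⟨φ.subst ρ, g⟩) := by
  -- The two halves must be proved together: for an implication, each half uses the opposite half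
  -- for the antecedent.
  induction φ generalizing g Γ with
  | rel R ts => exact ⟨proves_of_mem, id⟩
  | flowsTo l l' => exact ⟨proves_of_mem, id⟩
  | canRead p l => exact ⟨proves_of_mem, id⟩
  | canWrite p l => exact ⟨proves_of_mem, id⟩
  | tru => exact ⟨fun _ => trivial, fun _ => .trueR⟩
  | fls =>
    refine ⟨fun h χ k => ProvesWith.falseL.absorb h, fun h => ?_⟩
    exact List.append_nil g ▸ h .fls []
  | and φ ψ ih₁ ih₂ =>
    refine ⟨fun h => ⟨.of_covered fun Δ hΔ b hb => ?_, .of_covered fun Δ hΔ b hb => ?_⟩,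
      fun h => .andR ((ih₁ ρ g Γ).2 h.1) ((ih₂ ρ g Γ).2 h.2)⟩
    · refine (ProvesWith.andL (hb _ ?_ ((ih₁ ρ g _).1 ?_))).absorb (hΔ h) <;> simp
    · refine (ProvesWith.andL (hb _ ?_ ((ih₂ ρ g _).1 ?_))).absorb (hΔ h) <;> simp
  | or φ ψ ih₁ ih₂ =>
    refine ⟨fun h Δ hΔ b hb => ?_, fun h => Covered.proves h fun Δ _ hP => ?_⟩
    · exact (ProvesWith.orL
        (hb _ (List.subset_cons_self _ _) (.inl ((ih₁ ρ g _).1 List.mem_cons_self)))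
        (hb _ (List.subset_cons_self _ _) (.inr ((ih₂ ρ g _).1 List.mem_cons_self)))).absorb (hΔ h)
    · exact hP.elim (fun hP => .orR1 ((ih₁ ρ g Δ).2 hP)) (fun hP => .orR2 ((ih₂ ρ g Δ).2 hP))
  | imp φ ψ ih₁ ih₂ =>
    refine ⟨fun h Δ hΔ hφ => .of_covered fun Δ' hΔ' b hb => ?_, fun h => .impR ?_⟩
    · exact (ProvesWith.impL (((ih₁ ρ [] Δ).2 hφ).mono hΔ')
        (hb _ (List.subset_cons_self _ _) ((ih₂ ρ g _).1 List.mem_cons_self))).absorb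
        (hΔ' (hΔ h))
    · exact (ih₂ ρ g _).2
        (h _ (List.subset_cons_self _ _) ((ih₁ ρ [] _).1 List.mem_cons_self))
  | all σ φ ih =>
    refine ⟨fun h t => .of_covered fun Δ hΔ b hb => ?_, fun h => ?_⟩
    · refine (ProvesWith.forallL t ?_).absorb (hΔ h)
      rw [Formula.subst_liftSubst_inst]
      exact hb _ (List.subset_cons_self _ _) ((ih _ g _).1 List.mem_cons_self)
    -- The universal is forced at all terms, in particular at a variable fresh enough to be the
    -- eigenvariable.
    · obtain ⟨x, hx⟩ := Ctx.exists_fresh σ (⟨(Formula.all σ φ).subst ρ, g⟩ :: Γ)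
      simp only [Ctx.Occurs, List.mem_cons, exists_eq_or_imp, not_or, Belief.Occurs] at hx
      refine .forallR x hx.2 hx.1.2 hx.1.1 ?_
      rw [Formula.subst_liftSubst_inst]
      exact (ih _ g Γ).2 (h _)
  | ex σ φ ih =>
    refine ⟨fun h Δ hΔ b hb => ?_, fun h => Covered.proves h fun Δ _ ⟨t, ht⟩ => ?_⟩
    -- Here `x` must also avoid the arbitrary goal `b`.
    · obtain ⟨x, hx⟩ := Ctx.exists_fresh σ (b :: ⟨(Formula.ex σ φ).subst ρ, g⟩ :: Δ)
      simp only [Ctx.Occurs, List.mem_cons, exists_eq_or_imp, not_or] at hx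
      refine (ProvesWith.existsL x hx.2.2 (fun H => hx.2.1 (.inr H)) (fun H => hx.2.1 (.inl H))
        hx.1 ?_).absorb (hΔ h)
      rw [Formula.subst_liftSubst_inst]
      exact hb _ (List.subset_cons_self _ _) ⟨_, (ih _ g _).1 List.mem_cons_self⟩
    · refine .existsR t ?_
      rw [Formula.subst_liftSubst_inst]
      exact (ih _ g Δ).2 ht
  | say p l φ ih =>
    refine ⟨fun h => .of_covered fun Δ hΔ b hb => ?_, fun h => .saysR ((ih ρ _ Γ).2 h)⟩
    exact (ProvesWith.saysL (hb _ (List.subset_cons_self _ _)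
      ((ih ρ _ _).1 List.mem_cons_self))).absorb (hΔ h)

/-! ### Soundness of FLAFOL with cut -/

/-- Simultaneous substitution in a generalized principal. -/
def GPrincipal.subst (ρ : Env S []) (g : GPrincipal S) : GPrincipal S :=
  g.map fun m => (m.1.subst ρ, m.2.subst ρ)

theorem GPrincipal.subst_var (g : GPrincipal S) : g.subst (fun _ x => .var x) = g := by
  simp [GPrincipal.subst, Term.subst_var]

theorem GPrincipal.subst_congr {ρ ρ' : Env S []} {g : GPrincipal S}
    (h : ∀ σ (x : Var S [] σ), g.Occurs x → ρ σ x = ρ' σ x) : g.subst ρ = g.subst ρ' :=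
  List.map_congr_left fun m hm => Prod.ext
    (Term.subst_congr fun σ x hx => h σ x ⟨m, hm, .inl hx⟩)
    (Term.subst_congr fun σ x hx => h σ x ⟨m, hm, .inr hx⟩)

/-- The contexts forcing a belief under an assignment of its free variables. -/
def Belief.Forced (b : Belief S) (ρ : Env S []) (Γ : Ctx S) : Prop :=
  b.formula.Forced ρ (b.gp.subst ρ) Γ

theorem Belief.forced_congr {b : Belief S} {ρ ρ' : Env S []}
    (h : ∀ σ (x : Var S [] σ), b.Occurs x → ρ σ x = ρ' σ x) : b.Forced ρ = b.Forced ρ' := by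
  funext Γ
  rw [Belief.Forced, Belief.Forced, Formula.forced_congr fun σ x hx => h σ x (.inl hx),
    GPrincipal.subst_congr fun σ x hx => h σ x (.inr hx)]

theorem Belief.forced_update {b : Belief S} {ρ ρ' : Env S []} {σ : S.Srt} {x : Var S [] σ}
    (hb : ¬ b.Occurs x)
    (h : ∀ τ (y : Var S [] τ), (⟨σ, x⟩ : Σ τ, Var S [] τ) ≠ ⟨τ, y⟩ → ρ' τ y = ρ τ y) :
    b.Forced ρ' = b.Forced ρ :=
  Belief.forced_congr fun τ y hy => h τ y fun e => by
    cases e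
    exact hb hy

theorem Formula.forced_inst_update {σ : S.Srt} {φ : Formula S [σ]} {ρ ρ' : Env S []} {x : Var S [] σ}
    {t : Term S [] σ} (hφ : ¬ φ.Occurs x.there) (hx : ρ' σ x = t)
    (h : ∀ τ (y : Var S [] τ), (⟨σ, x⟩ : Σ τ, Var S [] τ) ≠ ⟨τ, y⟩ → ρ' τ y = ρ τ y) :
    (φ.inst (.var x)).Forced ρ' = φ.Forced (Env.cons t ρ) := by
  rw [Formula.forced_inst, ← hx]
  refine Formula.forced_congr (Env.cons_congr (fun τ y hy => h τ y fun e => ?_) _)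
  cases e
  exact hφ hy

theorem GPrincipal.subst_update {g : GPrincipal S} {ρ ρ' : Env S []} {σ : S.Srt} {x : Var S [] σ}
    (hg : ¬ g.Occurs x)
    (h : ∀ τ (y : Var S [] τ), (⟨σ, x⟩ : Σ τ, Var S [] τ) ≠ ⟨τ, y⟩ → ρ' τ y = ρ τ y) :
    g.subst ρ' = g.subst ρ :=
  GPrincipal.subst_congr fun τ y hy => h τ y fun e => by
    cases e
    exact hg hy

section Modal

variable {φ : Formula S []} {ρ : Env S []} {p q : Term S [] S.principal} {l l' : Term S [] S.label}
  {g g' : GPrincipal S} {Γ : Ctx S}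

/-- Regrouping the stack as a changed prefix followed by `g'` brings it into the form that
`Formula.Forced.transport` moves. -/
theorem Belief.forced_self : Belief.Forced ⟨φ, g ++ (p, l) :: (p, l) :: g'⟩ ρ Γ ↔
    Belief.Forced ⟨φ, g ++ (p, l) :: g'⟩ ρ Γ := by
  simp only [Belief.Forced, GPrincipal.subst, List.map_append, List.map_cons]
  rw [List.append_cons, List.append_cons _ _ (List.map _ g'), List.append_cons _ _ (List.map _ g')]
  constructor <;> refine Formula.Forced.transport fun Δ _ χ k h => ?_ <;>
    simp only [List.append_assoc, List.cons_append, List.nil_append] at h ⊢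
  · exact .selfRInv h
  · exact .selfR h

/-- A forced flows-to belief is by definition a cut-free proof, so `h₂` is literally the side
premise of `varR`, at every extension of `Γ`. -/
theorem Belief.Forced.variance (h₁ : Belief.Forced ⟨φ, g ++ (p, l') :: g'⟩ ρ Γ)
    (h₂ : Belief.Forced ⟨.flowsTo l' l, g ++ [(p, l)]⟩ ρ Γ) :
    Belief.Forced ⟨φ, g ++ (p, l) :: g'⟩ ρ Γ := by
  simp only [Belief.Forced, GPrincipal.subst, List.map_append, List.map_cons] at h₁ h₂ ⊢
  rw [List.append_cons] at h₁ ⊢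
  refine Formula.Forced.transport (fun Δ hΔ χ k h => ?_) h₁
  simp only [List.append_assoc, List.cons_append, List.nil_append] at h ⊢
  exact .varR h (ProvesWith.mono h₂ hΔ)

theorem Belief.Forced.forward (h₁ : Belief.Forced ⟨φ, g ++ (p, l) :: g'⟩ ρ Γ)
    (h₂ : Belief.Forced ⟨.canRead q l, g ++ [(p, l)]⟩ ρ Γ)
    (h₃ : Belief.Forced ⟨.canWrite p l, g ++ [(q, l)]⟩ ρ Γ) :
    Belief.Forced ⟨φ, g ++ (q, l) :: g'⟩ ρ Γ := by
  simp only [Belief.Forced, GPrincipal.subst, List.map_append, List.map_cons] at h₁ h₂ h₃ ⊢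
  rw [List.append_cons] at h₁ ⊢
  refine Formula.Forced.transport (fun Δ hΔ χ k h => ?_) h₁
  simp only [List.append_assoc, List.cons_append, List.nil_append] at h ⊢
  exact .fwdR h (ProvesWith.mono h₂ hΔ) (ProvesWith.mono h₃ hΔ)

end Modal

/-- The assignment varies so that an eigenvariable can take any value; the world varies because
implications and covers look at extensions. -/
theorem ProvesWith.sound {Γ : Ctx S} {b : Belief S} (h : ProvesWith (CutRule S) Γ b) :
    ∀ (ρ : Env S []) (Δ : Ctx S), (∀ a ∈ Γ, a.Forced ρ Δ) → b.Forced ρ Δ := by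
  induction h with
  | extra hX _ ih =>
    intro ρ Δ hΓ
    cases hX with
    | cut Γ φ ψ g₁ g₂ =>
      simp only [List.mem_cons, List.not_mem_nil, or_false, forall_eq_or_imp, forall_eq] at ih
      -- The first entailment supplies the cut belief as a hypothesis of the second.
      exact ih.2 ρ Δ ⟨ih.1 ρ Δ hΓ, hΓ⟩
  | ax => exact fun ρ Δ hΓ => hΓ _ List.mem_cons_self
  | weakening _ ih => exact fun ρ Δ hΓ => ih ρ Δ fun a ha => hΓ a (List.mem_cons_of_mem _ ha)
  | contraction _ ih => exact fun ρ Δ hΓ => ih ρ Δ fun a ha => hΓ a (by simpa using ha)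
  | exchange _ ih =>
    refine fun ρ Δ hΓ => ih ρ Δ fun a ha => hΓ a ?_
    simp only [List.mem_append, List.mem_cons] at ha ⊢
    tauto
  | falseL =>
    intro ρ Δ hΓ
    have := hΓ _ List.mem_cons_self
    simp only [Belief.Forced, GPrincipal.subst, List.map_append]
    exact Formula.forced_of_false _ this _
  | trueR => exact fun _ _ _ => trivial
  | andL _ ih =>
    intro ρ Δ hΓ
    rw [List.forall_mem_cons] at hΓ
    refine ih ρ Δ ?_
    rw [List.forall_mem_cons, List.forall_mem_cons]
    exact ⟨hΓ.1.2, hΓ.1.1, hΓ.2⟩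
  | andR _ _ ih₁ ih₂ => exact fun ρ Δ hΓ => ⟨ih₁ ρ Δ hΓ, ih₂ ρ Δ hΓ⟩
  | orL _ _ ih₁ ih₂ =>
    intro ρ Δ hΓ
    rw [List.forall_mem_cons] at hΓ
    refine Formula.Forced.of_covered (Covered.imp hΓ.1 fun Δ' hs hP => ?_)
    have hΓ' := fun a ha => (hΓ.2 a ha).mono hs
    exact hP.elim (fun hP => ih₁ ρ Δ' (List.forall_mem_cons.2 ⟨hP, hΓ'⟩))
      (fun hP => ih₂ ρ Δ' (List.forall_mem_cons.2 ⟨hP, hΓ'⟩))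
  | orR1 _ ih =>
    exact fun ρ Δ hΓ => Covered.of fun Δ' hs => .inl ((ih ρ Δ hΓ).mono hs)
  | orR2 _ ih =>
    exact fun ρ Δ hΓ => Covered.of fun Δ' hs => .inr ((ih ρ Δ hΓ).mono hs)
  | impL _ _ ih₁ ih₂ =>
    intro ρ Δ hΓ
    rw [List.forall_mem_cons] at hΓ
    exact ih₂ ρ Δ (List.forall_mem_cons.2
      ⟨hΓ.1 Δ (List.Subset.refl Δ) (ih₁ ρ Δ hΓ.2), hΓ.2⟩)
  | impR _ ih =>
    exact fun ρ Δ hΓ Δ' hs hφ => ih ρ Δ' (List.forall_mem_cons.2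
      ⟨hφ, fun a ha => (hΓ a ha).mono hs⟩)
  | forallL t _ ih =>
    intro ρ Δ hΓ
    rw [List.forall_mem_cons] at hΓ
    refine ih ρ Δ (List.forall_mem_cons.2 ⟨?_, hΓ.2⟩)
    rw [Belief.Forced, Formula.forced_inst]
    exact hΓ.1 _
  | forallR x hx hg hφ _ ih =>
    intro ρ Δ hΓ t
    -- Sending the eigenvariable to `t` turns the premise into the instance at `t`, and leaves `Γ`,
    -- the stack and the body unaffected.
    obtain ⟨ρ', hρx, hρ⟩ := ρ.exists_update x t
    have := ih ρ' Δ fun a ha => by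
      rw [Belief.forced_update (fun H => hx ⟨a, ha, H⟩) hρ]
      exact hΓ a ha
    rwa [Belief.Forced, Formula.forced_inst_update hφ hρx hρ, GPrincipal.subst_update hg hρ] at this
  | existsL x hx hg hφ hb _ ih =>
    intro ρ Δ hΓ
    rw [List.forall_mem_cons] at hΓ
    refine Formula.Forced.of_covered (Covered.imp hΓ.1 fun Δ' hs ⟨t, ht⟩ => ?_)
    obtain ⟨ρ', hρx, hρ⟩ := ρ.exists_update x t
    have := ih ρ' Δ' (List.forall_mem_cons.2 ⟨?_, fun a ha => ?_⟩)
    · rwa [Belief.forced_update hb hρ] at this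
    · rw [Belief.Forced, Formula.forced_inst_update hφ hρx hρ, GPrincipal.subst_update hg hρ]
      exact ht
    · rw [Belief.forced_update (fun H => hx ⟨a, ha, H⟩) hρ]
      exact (hΓ.2 a ha).mono hs
  | existsR t _ ih =>
    refine fun ρ Δ hΓ => Covered.of fun Δ' hs => ⟨t.subst ρ, ?_⟩
    rw [← Formula.forced_inst]
    exact (ih ρ Δ hΓ).mono hs
  | saysL _ ih =>
    intro ρ Δ hΓ
    rw [List.forall_mem_cons] at hΓ
    refine ih ρ Δ (List.forall_mem_cons.2 ⟨?_, hΓ.2⟩)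
    rw [Belief.Forced, GPrincipal.subst, List.map_append]
    exact hΓ.1
  | saysR _ ih =>
    intro ρ Δ hΓ
    have := ih ρ Δ hΓ
    rw [Belief.Forced, GPrincipal.subst, List.map_append] at this
    exact this
  | selfL _ ih =>
    intro ρ Δ hΓ
    rw [List.forall_mem_cons] at hΓ
    exact ih ρ Δ (List.forall_mem_cons.2 ⟨Belief.forced_self.1 hΓ.1, hΓ.2⟩)
  | selfLInv _ ih =>
    intro ρ Δ hΓ
    rw [List.forall_mem_cons] at hΓ
    exact ih ρ Δ (List.forall_mem_cons.2 ⟨Belief.forced_self.2 hΓ.1, hΓ.2⟩)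
  | selfR _ ih => exact fun ρ Δ hΓ => Belief.forced_self.2 (ih ρ Δ hΓ)
  | selfRInv _ ih => exact fun ρ Δ hΓ => Belief.forced_self.1 (ih ρ Δ hΓ)
  | varL _ _ ih₁ ih₂ =>
    intro ρ Δ hΓ
    have h := List.forall_mem_cons.1 hΓ
    -- The side premise is entailed by the unchanged context, so it is forced too; `variance` then
    -- moves the hypothesis from `l` to `l'`.
    exact ih₁ ρ Δ (List.forall_mem_cons.2 ⟨h.1.variance (ih₂ ρ Δ hΓ), h.2⟩)
  | varR _ _ ih₁ ih₂ => exact fun ρ Δ hΓ => (ih₁ ρ Δ hΓ).variance (ih₂ ρ Δ hΓ)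
  | fwdL _ _ _ ih₁ ih₂ ih₃ =>
    intro ρ Δ hΓ
    have h := List.forall_mem_cons.1 hΓ
    exact ih₁ ρ Δ (List.forall_mem_cons.2 ⟨h.1.forward (ih₂ ρ Δ hΓ) (ih₃ ρ Δ hΓ), h.2⟩)
  | fwdR _ _ _ ih₁ ih₂ ih₃ =>
    exact fun ρ Δ hΓ => (ih₁ ρ Δ hΓ).forward (ih₂ ρ Δ hΓ) (ih₃ ρ Δ hΓ)
  | flowsToRefl => exact fun _ _ _ => ProvesWith.flowsToRefl
  | flowsToTrans _ _ ih₁ ih₂ => exact fun ρ Δ hΓ => .flowsToTrans (ih₁ ρ Δ hΓ) (ih₂ ρ Δ hΓ)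
  | crVar _ _ ih₁ ih₂ => exact fun ρ Δ hΓ => .crVar (ih₁ ρ Δ hΓ) (ih₂ ρ Δ hΓ)
  | cwVar _ _ ih₁ ih₂ => exact fun ρ Δ hΓ => .cwVar (ih₁ ρ Δ hΓ) (ih₂ ρ Δ hΓ)

theorem admissible_cutRule (S : Signature.{u, v, w}) : Admissible (CutRule S) := by
  intro Γ b h
  -- The world is `Γ` itself, which forces each of its members.
  have := h.sound (fun _ x => .var x) Γ fun a ha => by
    rw [Belief.Forced, GPrincipal.subst_var]
    refine (Formula.forced_of_mem_and_proves _ _ _ _).1 ?_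
    rwa [Formula.subst_var]
  rw [Belief.Forced, GPrincipal.subst_var] at this
  simpa only [Formula.subst_var] using (Formula.forced_of_mem_and_proves _ _ _ _).2 this

/-- Needed to place two cut-free derivations above a cut. -/
theorem ProvesWith.of_proves (X : Rule S) {Γ : Ctx S} {b : Belief S} (h : Proves Γ b) :
    ProvesWith X Γ b := by
  induction h with
  | extra hX => exact hX.elim
  | forallL t _ ih => exact .forallL t ih
  | existsR t _ ih => exact .existsR t ih
  | forallR x hΓ hg hφ _ ih => exact .forallR x hΓ hg hφ ih
  | existsL x hΓ hg hφ hb _ ih => exact .existsL x hΓ hg hφ hb ih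
  | ax => exact .ax
  | weakening _ ih => exact .weakening ih
  | contraction _ ih => exact .contraction ih
  | exchange _ ih => exact .exchange ih
  | falseL => exact .falseL
  | trueR => exact .trueR
  | andL _ ih => exact .andL ih
  | andR _ _ ih₁ ih₂ => exact .andR ih₁ ih₂
  | orL _ _ ih₁ ih₂ => exact .orL ih₁ ih₂
  | orR1 _ ih => exact .orR1 ih
  | orR2 _ ih => exact .orR2 ih
  | impL _ _ ih₁ ih₂ => exact .impL ih₁ ih₂
  | impR _ ih => exact .impR ih
  | saysL _ ih => exact .saysL ih
  | saysR _ ih => exact .saysR ih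
  | selfL _ ih => exact .selfL ih
  | selfLInv _ ih => exact .selfLInv ih
  | selfR _ ih => exact .selfR ih
  | selfRInv _ ih => exact .selfRInv ih
  | varL _ _ ih₁ ih₂ => exact .varL ih₁ ih₂
  | varR _ _ ih₁ ih₂ => exact .varR ih₁ ih₂
  | fwdL _ _ _ ih₁ ih₂ ih₃ => exact .fwdL ih₁ ih₂ ih₃
  | fwdR _ _ _ ih₁ ih₂ ih₃ => exact .fwdR ih₁ ih₂ ih₃
  | flowsToRefl => exact .flowsToRefl
  | flowsToTrans _ _ ih₁ ih₂ => exact .flowsToTrans ih₁ ih₂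
  | crVar _ _ ih₁ ih₂ => exact .crVar ih₁ ih₂
  | cwVar _ _ ih₁ ih₂ => exact .cwVar ih₁ ih₂

end FLAFOL

theorem mainTheorem2 (S : FLAFOL.Signature) :
    FLAFOL.Admissible (FLAFOL.CutRule S) ∧
      ∀ (Γ : FLAFOL.Ctx S) (φ ψ : FLAFOL.Formula S []) (g₁ g₂ : FLAFOL.GPrincipal S),
        FLAFOL.Proves Γ ⟨φ, g₁⟩ →
        FLAFOL.Proves (⟨φ, g₁⟩ :: Γ) ⟨ψ, g₂⟩ →
        FLAFOL.Proves Γ ⟨ψ, g₂⟩ := by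
  refine ⟨FLAFOL.admissible_cutRule S, fun Γ φ ψ g₁ g₂ h₁ h₂ => ?_⟩
  refine FLAFOL.admissible_cutRule S _ _ (.extra (FLAFOL.CutRule.cut Γ φ ψ g₁ g₂) ?_)
  simp only [List.mem_cons, List.not_mem_nil, or_false, forall_eq_or_imp, forall_eq]
  exact ⟨h₁.of_proves _, h₂.of_proves _⟩
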